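/- Let $d\ge 1$ and $n\ge 1$ be integers, and let $M_{d,n}$ be the space of complex matrices indexed by $\{1,\dots,d\}^n$, i.e. matrices of operators on $(\mathbb C^d)^{\otimes n}$ in a product orthonormal basis. An unnormalized $n$-qudit density matrix is a positive semidefinite $\rho\in M_{d,n}$. It is called (fully) separable if it belongs to the convex cone generated by the tensor products $A_1\otimes\cdots\otimes A_n$ of positive semidefinite $d\times d$ matrices. Let $\|A\|_2=\sqrt{\operatorname{tr}A^\dagger A}$ be the Frobenius norm and put $$r_n=r_n(d)=\sqrt{\frac{d^n}{(2d-1)^{n-2}(d^2-1)+1}}.$$ **Theorem.** 1. Every unnormalized $n$-qudit density matrix $\rho$ with $\|\rho-I\|_2\le r_n$ is fully separable. 2. For each $d\ge1$, $(r_n)_{n\ge2}$ is the unique real sequence $(a_n)_{n\ge 2}$ with $a_2=1$ and $$a_n=a_{n-1}\sqrt{\frac{d}{2\left(1-a_{n-1}^2/d^{\,n-1}\right)(d-1)+1}}\qquad(n\ge3).$$ 3. For qubits ($d=2$) and all $n\ge1$, $$r_n=\sqrt{\frac{2^n}{3^{n-1}+1}}=\sqrt{\frac{3^{n+1}}{3^n+3}}\;2^{-\gamma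 n},\qquad \gamma=\tfrac12(\log_2 3-1),$$ and consequently $r_n/2^{-\gamma n}\to\sqrt3$ as $n\to\infty$. -/

import Mathlib

open scoped ComplexOrder Matrix.Norms.Frobenius

noncomputable section

/-- Index type of the product basis `e_{i 0} ⊗ ⋯ ⊗ e_{i (n-1)}` of an `n`-partite system all of
whose subsystems have dimension `d`. -/
abbrev QuditIndex (d n : ℕ) : Type := Fin n → Fin d

/-- Matrices of operators on `(ℂ^d)^{⊗ n}`, in the product basis. -/
abbrev QuditMatrix (d n : ℕ) : Type := Matrix (QuditIndex d n) (QuditIndex d n) ℂ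

/-- The tensor product `A 0 ⊗ ⋯ ⊗ A (n-1)` of `d × d` matrices, in the product basis. -/
def tensorMatrix {d n : ℕ} (A : Fin n → Matrix (Fin d) (Fin d) ℂ) : QuditMatrix d n :=
  Matrix.of fun i j => ∏ k, A k (i k) (j k)

/-- The (fully) separable cone: the convex cone generated by the tensor products
`A 0 ⊗ ⋯ ⊗ A (n-1)` with all the `A k` positive semidefinite. -/
def separableCone (d n : ℕ) : PointedCone ℝ (QuditMatrix d n) :=
  PointedCone.hull ℝ {X | ∃ A : Fin n → Matrix (Fin d) (Fin d) ℂ,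
    (∀ k, (A k).PosSemidef) ∧ X = tensorMatrix A}

/-- Full separability of an (unnormalized) `n`-qudit density matrix. -/
def IsFullySeparable {d n : ℕ} (ρ : QuditMatrix d n) : Prop := ρ ∈ separableCone d n

/-- `r_n = sqrt (d^n / ((2d-1)^(n-2) (d²-1) + 1))`; the exponent `n - 2` is taken in `ℤ`. -/
def sepRadius (d n : ℕ) : ℝ :=
  Real.sqrt ((d : ℝ) ^ n / ((2 * (d : ℝ) - 1) ^ ((n : ℤ) - 2) * ((d : ℝ) ^ 2 - 1) + 1))

/-- `γ = (log₂ 3 - 1) / 2`. -/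
def qubitExponent : ℝ := 1 / 2 * (Real.logb 2 3 - 1)

end

/-! By duality, a positive semidefinite ρ is separable as soon as tr(Wρ) ≥ 0 for every Hermitian W
nonnegative on products of positive matrices (`isFullySeparable_of_forall_witness`). Since tr(Wρ) =
tr W + tr(W(ρ - 1)), Cauchy–Schwarz reduces the ball, for n ≥ 2, to the estimate ‖W‖² ≤ c_n (tr W)²
with c_n = 1/r_n² (`IsSeparabilityWitness.norm_sq_le`), which goes by induction on n.

For n = 2, contracting W with a vector x on one factor gives a positive semidefinite matrix with
entries ⟨x, B_ij x⟩, so |⟨x, B_ij x⟩|² ≤ ⟨x, B_ii x⟩⟨x, B_jj x⟩. Then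
`sum_norm_sq_le_of_inner_sq_le` yields ‖B_ij‖² ≤ tr B_ii tr B_jj, and summing over i, j gives c_2 =
1.

For the induction, compressing W to a vector of the first factor gives a witness on one subsystem
fewer. Testing with combinations of two basis vectors and averaging over phases bounds the blocks of
W (`sum_norm_sq_le_of_compression`). The result, c_{n+1} = 2(c_n - d^{-n})(1 - 1/d) + c_n/d, is the
recursion of the radii. -/

/-! ### Frobenius norm of an operator whose quadratic form is dominated -/

/-- Every unitary operator on a finite-dimensional space is a combination of orthogonal projections
that add up to the identity, with coefficients of modulus one. -/
lemma exists_spectral_resolution_of_unitary {E : Type*} [NormedAddCommGroup E]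
    [InnerProductSpace ℂ E] [FiniteDimensional ℂ E] (U : E →L[ℂ] E) (hU : U ∈ unitary (E →L[ℂ] E)) :
    ∃ (s : Finset ℂ) (P : ℂ → E →L[ℂ] E), (∀ z ∈ s, ‖z‖ = 1) ∧
      (∀ z, star (P z) * P z = P z) ∧ ∑ z ∈ s, P z = 1 ∧ ∑ z ∈ s, z • P z = U := by
  have := FiniteDimensional.complete ℂ E
  have hN : IsStarNormal U := ⟨by
    rw [Unitary.mem_iff] at hU
    rw [Commute, SemiconjBy, hU.1, hU.2]⟩
  -- On a finite spectrum every function is continuous, so the functional calculus applies to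
  -- indicators of points; these give the spectral projections.
  have hfin : (spectrum ℂ U).Finite :=
    ContinuousLinearMap.spectrum_eq (f := U) ▸ Module.End.finite_spectrum (U : E →ₗ[ℂ] E)
  have hc : ∀ f : ℂ → ℂ, ContinuousOn f (spectrum ℂ U) := fun f => hfin.continuousOn f
  refine ⟨hfin.toFinset, fun z => cfc (fun w : ℂ => if w = z then (1 : ℂ) else 0) U, ?_, ?_, ?_, ?_⟩
  · intro z hz
    exact spectrum.norm_eq_one_of_unitary hU (hfin.mem_toFinset.1 hz)
  · intro z
    rw [← cfc_star, ← cfc_mul _ _ U (hc _) (hc _)]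
    congr 1
    ext w
    split_ifs <;> simp
  · rw [← cfc_sum _ U _ (fun i _ => hc _), ← cfc_one ℂ U]
    refine cfc_congr fun w hw => ?_
    simp [Finset.sum_apply, hfin.mem_toFinset.2 hw]
  · simp_rw [← cfc_smul _ _ U (hc _)]
    rw [← cfc_sum _ U _ (fun i _ => hc _)]
    conv_rhs => rw [← cfc_id ℂ U]
    refine cfc_congr fun w hw => ?_
    simp [Finset.sum_apply]
    intro h
    exact absurd hw h

/-- Singular value decomposition. -/
lemma exists_orthonormalBasis_map_eq_norm_smul {E : Type*} [NormedAddCommGroup E]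
    [InnerProductSpace ℂ E] [FiniteDimensional ℂ E] (B : E →L[ℂ] E) :
    ∃ v f : OrthonormalBasis (Fin (Module.finrank ℂ E)) ℂ E,
      ∀ k, B (v k) = (‖B (v k)‖ : ℂ) • f k := by
  let T : E →ₗ[ℂ] E := B.toLinearMap
  have hS := T.isSymmetric_adjoint_comp_self
  -- An eigenbasis of B*B has mutually orthogonal images under B; the nonzero ones, normalized,
  -- extend to the basis f.
  set v := hS.eigenvectorBasis rfl with hv
  have horth : ∀ j k, j ≠ k → inner ℂ (B (v j)) (B (v k)) = 0 := by
    intro j k hjk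
    have h1 : inner ℂ (T (v j)) (T (v k)) = inner ℂ (v j) ((LinearMap.adjoint T ∘ₗ T) (v k)) := by
      rw [LinearMap.comp_apply, LinearMap.adjoint_inner_right]
    change inner ℂ (T (v j)) (T (v k)) = 0
    rw [h1, hv, hS.apply_eigenvectorBasis, inner_smul_right, ← hv,
      v.orthonormal.2 hjk, mul_zero]
  obtain ⟨f, hf⟩ := Orthonormal.exists_orthonormalBasis_extension_of_card_eq (𝕜 := ℂ) (E := E)
    (ι := Fin (Module.finrank ℂ E)) (by simp)
    (v := fun k => ((‖B (v k)‖⁻¹ : ℝ) : ℂ) • B (v k)) (s := {k | B (v k) ≠ 0}) (by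
      refine ⟨fun ⟨k, hk⟩ => ?_, fun ⟨j, hj⟩ ⟨k, hk⟩ hjk => ?_⟩
      · have : ‖B (v k)‖ ≠ 0 := norm_ne_zero_iff.2 hk
        simp [Set.domRestrict, norm_smul, this]
      · have : j ≠ k := fun h => hjk (Subtype.ext h)
        simp [Set.domRestrict, inner_smul_left, inner_smul_right, horth j k this])
  refine ⟨v, f, fun k => ?_⟩
  by_cases hk : B (v k) = 0
  · simp [hk]
  · have : (‖B (v k)‖ : ℂ) ≠ 0 := by exact_mod_cast norm_ne_zero_iff.2 hk
    rw [hf k hk, smul_smul, Complex.ofReal_inv, mul_inv_cancel₀ this, one_smul]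

/-- The singular vectors give a unitary U for which tr(BU) is the trace norm of B, which dominates
the Frobenius norm. Writing U = ∑ z P_z with |z| = 1 bounds tr(BU) by the sum of |⟨y, By⟩| over the
vectors y = P_z b_i. Over the same vectors ⟨y, Ay⟩ and ⟨y, Cy⟩ sum to tr A and tr C, so
Cauchy–Schwarz concludes. -/
lemma sum_norm_sq_le_of_inner_sq_le {E : Type*} {ι : Type} [NormedAddCommGroup E] [Fintype ι]
    [InnerProductSpace ℂ E] [FiniteDimensional ℂ E] (b : OrthonormalBasis ι ℂ E)
    (A B C : E →L[ℂ] E) (hA : ∀ x, 0 ≤ (inner ℂ x (A x)).re) (hC : ∀ x, 0 ≤ (inner ℂ x (C x)).re)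
    (h : ∀ x, ‖inner ℂ x (B x)‖ ^ 2 ≤ (inner ℂ x (A x)).re * (inner ℂ x (C x)).re) :
    ∑ i, ‖B (b i)‖ ^ 2 ≤
      (∑ i, (inner ℂ (b i) (A (b i))).re) * ∑ i, (inner ℂ (b i) (C (b i))).re := by
  have := FiniteDimensional.complete ℂ E
  obtain ⟨tr, tr_eq, tr_comm⟩ : ∃ tr : (E →L[ℂ] E) →ₗ[ℂ] ℂ,
      (∀ {κ : Type} [Fintype κ] (c : OrthonormalBasis κ ℂ E) (T : E →L[ℂ] E),
        tr T = ∑ i, inner ℂ (c i) (T (c i))) ∧ ∀ S T : E →L[ℂ] E, tr (S * T) = tr (T * S) :=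
    ⟨LinearMap.trace ℂ E ∘ₗ ContinuousLinearMap.coeLM ℂ,
      fun c T => LinearMap.trace_eq_sum_inner T.toLinearMap c,
      fun S T => LinearMap.trace_mul_comm ℂ S.toLinearMap T.toLinearMap⟩
  obtain ⟨v, f, hvf⟩ := exists_orthonormalBasis_map_eq_norm_smul B
  obtain ⟨U, hU, hUf⟩ : ∃ U ∈ unitary (E →L[ℂ] E), ∀ k, U (f k) = v k :=
    ⟨Unitary.linearIsometryEquiv.symm (f.equiv v (Equiv.refl _)), Subtype.prop _, by simp⟩
  obtain ⟨s, P, hs, hP, hP1, hPU⟩ := exists_spectral_resolution_of_unitary U hU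
  have hTP : ∀ (T : E →L[ℂ] E) z, tr (T * P z) = ∑ i, inner ℂ (P z (b i)) (T (P z (b i))) := by
    intro T z
    have hPP : P z * star (P z) = P z := by
      have h1 : star (P z) = P z := by
        rw [← hP z, star_mul, star_star]
      rw [h1]
      nth_rw 1 [← h1]
      exact hP z
    have : tr (T * P z) = tr (star (P z) * (T * P z)) := by
      rw [tr_comm (star (P z)), mul_assoc, hPP]
    rw [this, tr_eq b]
    refine Finset.sum_congr rfl fun i _ => ?_
    rw [mul_apply_eq_comp, mul_apply_eq_comp,
      ContinuousLinearMap.star_eq_adjoint, ContinuousLinearMap.adjoint_inner_right]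
  have hsum : ∀ T : E →L[ℂ] E, tr T = ∑ z ∈ s, ∑ i, inner ℂ (P z (b i)) (T (P z (b i))) := by
    intro T
    simp_rw [← hTP, ← map_sum, ← Finset.mul_sum, hP1, mul_one]
  have hBU : tr (B * U) = ∑ z ∈ s, z * ∑ i, inner ℂ (P z (b i)) (B (P z (b i))) := by
    simp_rw [← hTP]
    rw [← hPU, Finset.mul_sum, map_sum]
    simp
  have hBU' : tr (B * U) = ((∑ k, ‖B (v k)‖ : ℝ) : ℂ) := by
    rw [tr_eq f, Complex.ofReal_sum]
    refine Finset.sum_congr rfl fun k _ => ?_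
    rw [mul_apply_eq_comp, hUf, hvf, inner_smul_right]
    simp [norm_smul]
  have hF : ∑ i, ‖B (b i)‖ ^ 2 = ∑ k, ‖B (v k)‖ ^ 2 := by
    have key : ∀ {κ : Type} [Fintype κ] (c : OrthonormalBasis κ ℂ E),
        ((∑ i, ‖B (c i)‖ ^ 2 : ℝ) : ℂ) = tr (star B * B) := by
      intro κ _ c
      rw [tr_eq c, Complex.ofReal_sum]
      refine Finset.sum_congr rfl fun k _ => ?_
      rw [mul_apply_eq_comp, ContinuousLinearMap.star_eq_adjoint,
        ContinuousLinearMap.adjoint_inner_right, inner_self_eq_norm_sq_to_K]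
      simp
    exact_mod_cast (key b).trans (key v).symm
  have hle : ∑ k, ‖B (v k)‖ ≤ ∑ p ∈ s ×ˢ Finset.univ,
      ‖inner ℂ (P p.1 (b p.2)) (B (P p.1 (b p.2)))‖ := by
    have h0 : 0 ≤ ∑ k, ‖B (v k)‖ := Finset.sum_nonneg fun _ _ => norm_nonneg _
    have : ∑ k, ‖B (v k)‖ = ‖tr (B * U)‖ := by
      rw [hBU', Complex.norm_real, Real.norm_of_nonneg h0]
    rw [this, hBU, Finset.sum_product]
    refine (norm_sum_le _ _).trans (Finset.sum_le_sum fun z hz => ?_)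
    rw [norm_mul, hs z hz, one_mul]
    exact norm_sum_le _ _
  have hre : ∀ T : E →L[ℂ] E, ∑ i, (inner ℂ (b i) (T (b i))).re =
      ∑ p ∈ s ×ˢ Finset.univ, (inner ℂ (P p.1 (b p.2)) (T (P p.1 (b p.2)))).re := by
    intro T
    have := congrArg Complex.re ((tr_eq b T).symm.trans (hsum T))
    rw [Finset.sum_product]
    simpa using this
  rw [hF, hre A, hre C]
  calc ∑ k, ‖B (v k)‖ ^ 2 ≤ (∑ k, ‖B (v k)‖) ^ 2 :=
        Finset.sum_sq_le_sq_sum_of_nonneg fun _ _ => norm_nonneg _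
    _ ≤ (∑ p ∈ s ×ˢ Finset.univ, ‖inner ℂ (P p.1 (b p.2)) (B (P p.1 (b p.2)))‖) ^ 2 :=
        pow_le_pow_left₀ (Finset.sum_nonneg fun _ _ => norm_nonneg _) hle 2
    _ ≤ _ := Finset.sum_sq_le_sum_mul_sum_of_sq_le_mul _ (fun _ _ => hA _) (fun _ _ => hC _)
        fun _ _ => h _

/-! ### Bipartite block matrices -/

lemma sum_sum_comm_sum_sum {ι κ M : Type*} [Fintype ι] [Fintype κ] [AddCommMonoid M]
    (f : κ → κ → ι → ι → M) :
    ∑ k, ∑ l, ∑ i, ∑ j, f k l i j = ∑ i, ∑ j, ∑ k, ∑ l, f k l i j := by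
  calc ∑ k, ∑ l, ∑ i, ∑ j, f k l i j = ∑ p : κ × κ, ∑ q : ι × ι, f p.1 p.2 q.1 q.2 := by
        simp only [Fintype.sum_prod_type]
    _ = ∑ q : ι × ι, ∑ p : κ × κ, f p.1 p.2 q.1 q.2 := Finset.sum_comm
    _ = _ := by simp only [Fintype.sum_prod_type]

open Matrix in
lemma frobenius_norm_sq_eq_sum {ι κ : Type*} [Fintype ι] [Fintype κ] (A : Matrix ι κ ℂ) :
    ‖A‖ ^ 2 = ∑ i, ∑ j, ‖A i j‖ ^ 2 := by
  rw [frobenius_norm_def, ← Real.sqrt_eq_rpow, Real.sq_sqrt]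
  · simp
  · positivity

open Matrix in
lemma frobenius_norm_sq_le_of_quadratic {κ : Type} [Fintype κ] [DecidableEq κ]
    (A B C : Matrix κ κ ℂ) (hA : ∀ x, 0 ≤ (star x ⬝ᵥ A *ᵥ x).re)
    (hC : ∀ x, 0 ≤ (star x ⬝ᵥ C *ᵥ x).re)
    (h : ∀ x, ‖star x ⬝ᵥ B *ᵥ x‖ ^ 2 ≤ (star x ⬝ᵥ A *ᵥ x).re * (star x ⬝ᵥ C *ᵥ x).re) :
    ‖B‖ ^ 2 ≤ A.trace.re * C.trace.re := by
  have hin : ∀ (M : Matrix κ κ ℂ) (x : EuclideanSpace ℂ κ),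
      inner ℂ x (toEuclideanCLM (𝕜 := ℂ) M x) = star x.ofLp ⬝ᵥ M *ᵥ x.ofLp := by
    intro M x
    rw [EuclideanSpace.inner_eq_star_dotProduct, ofLp_toEuclideanCLM, dotProduct_comm]
  have htr : ∀ M : Matrix κ κ ℂ, ∑ i, (inner ℂ (EuclideanSpace.basisFun κ ℂ i)
      (toEuclideanCLM (𝕜 := ℂ) M (EuclideanSpace.basisFun κ ℂ i))).re = M.trace.re := by
    intro M
    rw [Matrix.trace, Complex.re_sum]
    refine Finset.sum_congr rfl fun i _ => ?_
    rw [hin]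
    simp
  have key := sum_norm_sq_le_of_inner_sq_le (EuclideanSpace.basisFun κ ℂ)
    (toEuclideanCLM (𝕜 := ℂ) A) (toEuclideanCLM (𝕜 := ℂ) B) (toEuclideanCLM (𝕜 := ℂ) C)
    (fun x => by rw [hin]; exact hA _) (fun x => by rw [hin]; exact hC _)
    (fun x => by rw [hin, hin, hin]; exact h _)
  rw [htr, htr] at key
  refine le_of_eq_of_le ?_ key
  rw [frobenius_norm_sq_eq_sum, Finset.sum_comm]
  refine Finset.sum_congr rfl fun j _ => ?_
  rw [EuclideanSpace.norm_sq_eq]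
  simp

-- Nonnegativity of the 2 × 2 principal minor on rows i and j.
open Matrix in
lemma Matrix.PosSemidef.norm_sq_apply_le {ι : Type*} [Fintype ι] {M : Matrix ι ι ℂ}
    (hM : M.PosSemidef) (i j : ι) : ‖M i j‖ ^ 2 ≤ (M i i).re * (M j j).re := by
  have h := (hM.submatrix ![i, j]).det_nonneg
  rw [det_fin_two] at h
  have h1 : M j i = star (M i j) := (hM.1.apply j i).symm
  have h2 : ∀ i, (M i i).im = 0 := fun i => by
    have := congrArg Complex.im (hM.1.apply i i)
    simp at this
    linarith
  have := (Complex.le_def.1 h).1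
  simp [h1, h2] at this
  rw [← Complex.normSq_eq_norm_sq, Complex.normSq_apply]
  linarith

open Matrix in
/-- A matrix on `ℂ^ι ⊗ ℂ^κ`, with blocks `m k l`, that is nonnegative on product vectors has
Frobenius norm at most its trace. -/
lemma sum_norm_sq_le_trace_sq_of_blockPositive {ι κ : Type} [Fintype ι] [Fintype κ]
    [DecidableEq ι] [DecidableEq κ]
    (m : κ → κ → Matrix ι ι ℂ) (hm : ∀ k l, (m k l)ᴴ = m l k)
    (h : ∀ (v : ι → ℂ) (x : κ → ℂ),
      0 ≤ (∑ k, ∑ l, star (x k) * x l * (star v ⬝ᵥ m k l *ᵥ v)).re) :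
    ∑ k, ∑ l, ‖m k l‖ ^ 2 ≤ (∑ k, m k k).trace.re ^ 2 := by
  -- `G x` contracts the κ factor with x; `B i j` holds the same entries with the roles of the
  -- factors exchanged, so that `G x i j` is the quadratic form of `B i j` at x.
  let G : (κ → ℂ) → Matrix ι ι ℂ := fun x => ∑ k, ∑ l, (star (x k) * x l) • m k l
  let B : ι → ι → Matrix κ κ ℂ := fun i j => of fun k l => m k l i j
  have hGB : ∀ x i j, G x i j = star x ⬝ᵥ B i j *ᵥ x := by
    intro x i j
    simp only [G, B, Matrix.sum_apply, dotProduct, mulVec, Matrix.smul_apply, of_apply,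
      Finset.mul_sum, smul_eq_mul, Pi.star_apply]
    exact Finset.sum_congr rfl fun _ _ => Finset.sum_congr rfl fun _ _ => by ring
  have hG : ∀ x, (G x).PosSemidef := by
    intro x
    have hH : (G x).IsHermitian := by
      simp only [G, IsHermitian, conjTranspose_sum, conjTranspose_smul, hm]
      rw [Finset.sum_comm]
      exact Finset.sum_congr rfl fun _ _ => Finset.sum_congr rfl fun _ _ => by
        simp [mul_comm]
    refine .of_dotProduct_mulVec_nonneg hH fun v => ?_
    rw [Complex.le_def]
    refine ⟨?_, ?_⟩
    · have := h v x
      simpa [G, sum_mulVec, dotProduct_sum, smul_mulVec, dotProduct_smul] using this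
    · exact (hH.im_star_dotProduct_mulVec_self v).symm
  have hB : ∀ i j, ‖B i j‖ ^ 2 ≤ (B i i).trace.re * (B j j).trace.re := by
    intro i j
    have hnn : ∀ i x, 0 ≤ (star x ⬝ᵥ B i i *ᵥ x).re := fun i x => by
      rw [← hGB]
      exact (Complex.le_def.1 (hG x).diag_nonneg).1
    refine frobenius_norm_sq_le_of_quadratic _ _ _ (hnn i) (hnn j) fun x => ?_
    rw [← hGB, ← hGB, ← hGB]
    exact (hG x).norm_sq_apply_le i j
  calc ∑ k, ∑ l, ‖m k l‖ ^ 2 = ∑ i, ∑ j, ‖B i j‖ ^ 2 := by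
        simp only [frobenius_norm_sq_eq_sum, B, of_apply]
        exact sum_sum_comm_sum_sum _
    _ ≤ ∑ i, ∑ j, (B i i).trace.re * (B j j).trace.re :=
        Finset.sum_le_sum fun i _ => Finset.sum_le_sum fun j _ => hB i j
    _ = (∑ i, (B i i).trace.re) ^ 2 := by rw [sq, Finset.sum_mul_sum]
    _ = _ := by
        congr 1
        simp only [Matrix.trace, B, diag_apply, of_apply, Complex.re_sum, Matrix.sum_apply]

/-! ### The induction step for block matrices -/

-- Sum over w = 1, -1, i, -i of |a + t(wb + w̄c)|²: the cross terms of a with b, c vanish because ∑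
-- w = 0, those of b with c because ∑ w² = 0.
open Complex in
lemma sum_norm_sq_four_phases (a b c : ℂ) (t : ℝ) :
    ‖a + t * (b + c)‖ ^ 2 + ‖a + t * (-b - c)‖ ^ 2 + ‖a + t * (I * b - I * c)‖ ^ 2 +
      ‖a + t * (-I * b + I * c)‖ ^ 2 = 4 * ‖a‖ ^ 2 + 4 * t ^ 2 * (‖b‖ ^ 2 + ‖c‖ ^ 2) := by
  simp only [← normSq_eq_norm_sq, normSq_apply]
  simp
  ring

open Matrix in
lemma star_dotProduct_mulVec_single_add_single {ι : Type*} [Fintype ι] [DecidableEq ι]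
    (M : Matrix ι ι ℂ) (i j : ι) (x y : ℂ) :
    star (Pi.single i x + Pi.single j y : ι → ℂ) ⬝ᵥ M *ᵥ (Pi.single i x + Pi.single j y) =
      star x * x * M i i + star y * y * M j j + (star x * y * M i j + star y * x * M j i) := by
  simp [Matrix.mulVec_add]
  ring

-- Test with x e_i + w y e_j and average over the four phases w. As the partial trace has no (i, j)
-- and (j, i) entries, the right-hand side does not depend on w. The phase-free part a has trace S,
-- hence squared norm at least S²/|κ|; this is the gain -1/|κ|.
open Matrix in
lemma two_mul_sq_mul_sum_norm_sq_le {ι κ : Type*} [Fintype ι] [Fintype κ] [Nonempty κ]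
    [DecidableEq ι]
    (m : κ → κ → Matrix ι ι ℂ) (hm : ∀ k l, (m k l)ᴴ = m l k) (c : ℝ)
    (h : ∀ v : ι → ℂ, ∑ k, ∑ l, ‖star v ⬝ᵥ m k l *ᵥ v‖ ^ 2 ≤
      c * (star v ⬝ᵥ (∑ k, m k k) *ᵥ v).re ^ 2)
    {i j : ι} (hij : (∑ k, m k k) i j = 0) (hji : (∑ k, m k k) j i = 0) (x y : ℝ) :
    2 * x ^ 2 * y ^ 2 * ∑ k, ∑ l, ‖m k l i j‖ ^ 2 ≤ (c - 1 / Fintype.card κ) *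
      (x ^ 2 * ((∑ k, m k k) i i).re + y ^ 2 * ((∑ k, m k k) j j).re) ^ 2 := by
  set T := ∑ k, m k k with hT
  set S := x ^ 2 * (T i i).re + y ^ 2 * (T j j).re with hS
  let a : κ → κ → ℂ := fun k l => x ^ 2 * m k l i i + y ^ 2 * m k l j j
  have hv : ∀ w : ℂ, star w * w = 1 →
      ∑ k, ∑ l, ‖a k l + (x * y : ℝ) * (w * m k l i j + star w * m k l j i)‖ ^ 2 ≤ c * S ^ 2 := by
    intro w hw
    have h1 := h (Pi.single i (x : ℂ) + Pi.single j (y * w : ℂ))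
    have h2 : ∀ M : Matrix ι ι ℂ, star (Pi.single i (x : ℂ) + Pi.single j (y * w : ℂ) : ι → ℂ) ⬝ᵥ
        M *ᵥ (Pi.single i (x : ℂ) + Pi.single j (y * w : ℂ)) =
        x ^ 2 * M i i + y ^ 2 * M j j + (x * y : ℝ) * (w * M i j + star w * M j i) := by
      intro M
      rw [star_dotProduct_mulVec_single_add_single]
      have : star (y * w : ℂ) * (y * w) = y ^ 2 * (star w * w) := by simp; ring
      rw [this, hw]
      simp
      ring
    simp only [h2] at h1
    rw [hij, hji] at h1
    refine h1.trans (le_of_eq ?_)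
    simp [hS, ← Complex.ofReal_pow]
  have hsum := add_le_add (add_le_add (add_le_add (hv 1 (by simp)) (hv (-1) (by simp)))
    (hv Complex.I (by simp))) (hv (-Complex.I) (by simp))
  simp only [← Finset.sum_add_distrib] at hsum
  have hph : ∀ k l, ‖a k l + (x * y : ℝ) * (1 * m k l i j + star 1 * m k l j i)‖ ^ 2 +
      ‖a k l + (x * y : ℝ) * (-1 * m k l i j + star (-1) * m k l j i)‖ ^ 2 +
      ‖a k l + (x * y : ℝ) * (Complex.I * m k l i j + star Complex.I * m k l j i)‖ ^ 2 +
      ‖a k l + (x * y : ℝ) * (-Complex.I * m k l i j + star (-Complex.I) * m k l j i)‖ ^ 2 =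
      4 * ‖a k l‖ ^ 2 + 4 * (x * y) ^ 2 * (‖m k l i j‖ ^ 2 + ‖m l k i j‖ ^ 2) := by
    intro k l
    have : ‖m l k i j‖ = ‖m k l j i‖ := by
      rw [← hm k l]
      simp
    rw [this, ← sum_norm_sq_four_phases (a k l) (m k l i j) (m k l j i) (x * y)]
    simp [sub_eq_add_neg]
  have hcomm : ∑ k, ∑ l, ‖m l k i j‖ ^ 2 = ∑ k, ∑ l, ‖m k l i j‖ ^ 2 := Finset.sum_comm
  simp only [hph, Finset.sum_add_distrib, ← Finset.mul_sum, hcomm] at hsum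
  have haS : S ^ 2 / Fintype.card κ ≤ ∑ k, ∑ l, ‖a k l‖ ^ 2 := by
    have h1 : S = ∑ k, (a k k).re := by
      simp [hS, hT, a, Matrix.sum_apply, Finset.sum_add_distrib, Finset.mul_sum,
        ← Complex.ofReal_pow]
    have hN : (0 : ℝ) < Fintype.card κ := by exact_mod_cast Fintype.card_pos
    rw [div_le_iff₀' hN, h1]
    refine sq_sum_le_card_mul_sum_sq.trans ?_
    rw [Finset.card_univ]
    gcongr with k
    refine le_trans ?_ (Finset.single_le_sum (fun l _ => sq_nonneg ‖a k l‖) (Finset.mem_univ k))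
    rw [← sq_abs]
    exact pow_le_pow_left₀ (abs_nonneg _) (Complex.abs_re_le_norm _) 2
  have : (c - 1 / Fintype.card κ) * S ^ 2 = c * S ^ 2 - S ^ 2 / Fintype.card κ := by ring
  rw [this]
  linarith

/-- For p, q > 0 the choice x² = q, y² = p suffices. If one of them vanishes, letting the weight
multiplying it grow forces β ≤ 0. -/
lemma le_mul_mul_of_forall_sq {β s p q : ℝ} (hp : 0 ≤ p) (hq : 0 ≤ q)
    (h : ∀ x y : ℝ, 2 * x ^ 2 * y ^ 2 * β ≤ s * (x ^ 2 * p + y ^ 2 * q) ^ 2) :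
    β ≤ 2 * s * (p * q) := by
  have h' : ∀ X Y : ℝ, 0 ≤ X → 0 ≤ Y → 2 * X * Y * β ≤ s * (X * p + Y * q) ^ 2 := by
    intro X Y hX hY
    simpa [Real.sq_sqrt hX, Real.sq_sqrt hY] using h √X √Y
  have hzero : ∀ r : ℝ, (∀ X : ℝ, 0 ≤ X → 2 * X * β ≤ s * r ^ 2) → β ≤ 0 := by
    intro r hr
    by_contra! hβ
    have h1 := hr ((|s * r ^ 2| + 1) / β) (by positivity)
    have h2 : 2 * ((|s * r ^ 2| + 1) / β) * β = 2 * (|s * r ^ 2| + 1) := by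
      field_simp
    have := le_abs_self (s * r ^ 2)
    have := abs_nonneg (s * r ^ 2)
    linarith
  rcases hp.eq_or_lt with rfl | hp'
  · simpa using hzero q fun X hX => by simpa using h' X 1 hX zero_le_one
  rcases hq.eq_or_lt with rfl | hq'
  · simpa using hzero p fun X hX => by simpa using h' 1 X zero_le_one hX
  have h1 := h' q p hq hp
  have hpq : 0 < 2 * (p * q) := by positivity
  refine le_of_mul_le_mul_left ?_ hpq
  calc 2 * (p * q) * β = 2 * q * p * β := by ring
    _ ≤ _ := h1
    _ = _ := by ring

open Matrix in
lemma sum_norm_sq_le_of_compression_of_diagonal {ι κ : Type*} [Fintype ι] [Fintype κ] [Nonempty ι]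
    [Nonempty κ] [DecidableEq ι]
    (m : κ → κ → Matrix ι ι ℂ) (hm : ∀ k l, (m k l)ᴴ = m l k) (c : ℝ)
    (hc : 2 ≤ c * Fintype.card κ)
    (h0 : ∀ v : ι → ℂ, 0 ≤ (star v ⬝ᵥ (∑ k, m k k) *ᵥ v).re)
    (h : ∀ v : ι → ℂ, ∑ k, ∑ l, ‖star v ⬝ᵥ m k l *ᵥ v‖ ^ 2 ≤
      c * (star v ⬝ᵥ (∑ k, m k k) *ᵥ v).re ^ 2)
    (hdiag : ∀ i j, i ≠ j → (∑ k, m k k) i j = 0) :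
    ∑ k, ∑ l, ‖m k l‖ ^ 2 ≤ (2 * (c - 1 / Fintype.card κ) * (1 - 1 / Fintype.card ι) +
      c / Fintype.card ι) * (∑ k, m k k).trace.re ^ 2 := by
  set T := ∑ k, m k k with hT
  let p : ι → ℝ := fun i => (T i i).re
  have hN : (0 : ℝ) < Fintype.card κ := by exact_mod_cast Fintype.card_pos
  have hd : (0 : ℝ) < Fintype.card ι := by exact_mod_cast Fintype.card_pos
  have hp : ∀ i, 0 ≤ p i := fun i => by simpa [p] using h0 (Pi.single i 1)
  set s := c - 1 / (Fintype.card κ : ℝ) with hs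
  have hβ : ∀ i j, ∑ k, ∑ l, ‖m k l i j‖ ^ 2 ≤
      2 * s * (p i * p j) + if i = j then (c - 2 * s) * p i ^ 2 else 0 := by
    intro i j
    split_ifs with hij
    · subst hij
      have := h (Pi.single i 1)
      simp at this
      refine this.trans (le_of_eq ?_)
      simp only [p]
      ring
    · rw [add_zero]
      exact le_mul_mul_of_forall_sq (hp i) (hp j) fun x y =>
        two_mul_sq_mul_sum_norm_sq_le m hm c h (hdiag i j hij) (hdiag j i (Ne.symm hij)) x y
  have htr : T.trace.re = ∑ i, p i := by simp [Matrix.trace, p]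
  -- The diagonal entries satisfy the bound c p_i² instead of 2s p_i². The hypothesis on c makes c -
  -- 2s nonpositive, so the lower bound for ∑ p_i² can be used.
  have hcs : c - 2 * s ≤ 0 := by
    have : 2 / (Fintype.card κ : ℝ) ≤ c := by rwa [div_le_iff₀ hN]
    have h3 : 2 * s = 2 * c - 2 / (Fintype.card κ : ℝ) := by rw [hs]; ring
    linarith
  have hsq : (∑ i, p i) ^ 2 / Fintype.card ι ≤ ∑ i, p i ^ 2 := by
    rw [div_le_iff₀' hd]
    simpa using sq_sum_le_card_mul_sum_sq (s := (Finset.univ : Finset ι)) (f := p)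
  calc ∑ k, ∑ l, ‖m k l‖ ^ 2 = ∑ i, ∑ j, ∑ k, ∑ l, ‖m k l i j‖ ^ 2 := by
        simp only [frobenius_norm_sq_eq_sum]
        exact sum_sum_comm_sum_sum _
    _ ≤ ∑ i, ∑ j, (2 * s * (p i * p j) + if i = j then (c - 2 * s) * p i ^ 2 else 0) :=
        Finset.sum_le_sum fun i _ => Finset.sum_le_sum fun j _ => hβ i j
    _ = 2 * s * (∑ i, p i) ^ 2 + (c - 2 * s) * ∑ i, p i ^ 2 := by
        simp only [Finset.sum_add_distrib, Finset.sum_ite_eq, Finset.mem_univ, if_true,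
          ← Finset.mul_sum, sq (∑ i, p i), Finset.sum_mul_sum]
    _ ≤ 2 * s * (∑ i, p i) ^ 2 + (c - 2 * s) * ((∑ i, p i) ^ 2 / Fintype.card ι) := by
        have := mul_le_mul_of_nonpos_left hsq hcs
        linarith
    _ = _ := by rw [htr]; ring

open Matrix in
lemma Matrix.frobenius_norm_unitary_conj {ι : Type*} [Fintype ι] [DecidableEq ι]
    {U : Matrix ι ι ℂ} (hU : U * Uᴴ = 1) (M : Matrix ι ι ℂ) : ‖Uᴴ * M * U‖ = ‖M‖ := by
  have key : ∀ A : Matrix ι ι ℂ, ‖A‖ ^ 2 = (Aᴴ * A).trace.re := by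
    intro A
    rw [frobenius_norm_sq_eq_sum, Finset.sum_comm]
    simp [Matrix.trace, mul_apply, ← Complex.normSq_eq_norm_sq, Complex.normSq_apply]
  refine (sq_eq_sq₀ (norm_nonneg _) (norm_nonneg _)).1 ?_
  rw [key, key]
  congr 1
  calc ((Uᴴ * M * U)ᴴ * (Uᴴ * M * U)).trace = (Uᴴ * (Mᴴ * (U * Uᴴ) * M * U)).trace := by
        simp only [conjTranspose_mul, conjTranspose_conjTranspose, mul_assoc]
    _ = (Mᴴ * M).trace := by
        rw [hU, mul_one, trace_mul_comm, mul_assoc _ U, hU, mul_one]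

open Matrix in
lemma Matrix.IsHermitian.exists_unitary_conj_diagonal {ι : Type*} [Fintype ι] [DecidableEq ι]
    {T : Matrix ι ι ℂ} (hT : T.IsHermitian) :
    ∃ U : Matrix ι ι ℂ, U * Uᴴ = 1 ∧ ∀ i j, i ≠ j → (Uᴴ * T * U) i j = 0 := by
  refine ⟨hT.eigenvectorUnitary, Unitary.mul_star_self_of_mem hT.eigenvectorUnitary.2,
    fun i j hij => ?_⟩
  have h := congrFun (congrFun hT.conjStarAlgAut_star_eigenvectorUnitary i) j
  rw [diagonal_apply_ne _ hij, Unitary.conjStarAlgAut_apply] at h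
  simpa [star_eq_conjTranspose] using h

open Matrix in
/-- If all compressions of a Hermitian block matrix to `v ⊗ ℂ^κ` have squared Frobenius norm at
most `c` times the square of their trace, the whole matrix satisfies the same with a larger
constant. -/
lemma sum_norm_sq_le_of_compression {ι κ : Type*} [Fintype ι] [Fintype κ] [Nonempty ι]
    [Nonempty κ] [DecidableEq ι]
    (m : κ → κ → Matrix ι ι ℂ) (hm : ∀ k l, (m k l)ᴴ = m l k) (c : ℝ)
    (hc : 2 ≤ c * Fintype.card κ)
    (h0 : ∀ v : ι → ℂ, 0 ≤ (star v ⬝ᵥ (∑ k, m k k) *ᵥ v).re)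
    (h : ∀ v : ι → ℂ, ∑ k, ∑ l, ‖star v ⬝ᵥ m k l *ᵥ v‖ ^ 2 ≤
      c * (star v ⬝ᵥ (∑ k, m k k) *ᵥ v).re ^ 2) :
    ∑ k, ∑ l, ‖m k l‖ ^ 2 ≤ (2 * (c - 1 / Fintype.card κ) * (1 - 1 / Fintype.card ι) +
      c / Fintype.card ι) * (∑ k, m k k).trace.re ^ 2 := by
  have hT : (∑ k, m k k).IsHermitian := by
    rw [IsHermitian, conjTranspose_sum]
    exact Finset.sum_congr rfl fun k _ => hm k k
  -- A change of basis on the ι factor diagonalizes the partial trace and preserves the norms, the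
  -- total trace and the family of compressions.
  obtain ⟨U, hU, hdiag⟩ := hT.exists_unitary_conj_diagonal
  let m' : κ → κ → Matrix ι ι ℂ := fun k l => Uᴴ * m k l * U
  have hsum : ∑ k, m' k k = Uᴴ * (∑ k, m k k) * U := by
    rw [Finset.mul_sum, Finset.sum_mul]
  have hq : ∀ (M : Matrix ι ι ℂ) v,
      star v ⬝ᵥ (Uᴴ * M * U) *ᵥ v = star (U *ᵥ v) ⬝ᵥ M *ᵥ (U *ᵥ v) := by
    intro M v
    rw [star_mulVec, ← dotProduct_mulVec, mulVec_mulVec, mulVec_mulVec, mul_assoc]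
  have key := sum_norm_sq_le_of_compression_of_diagonal m'
    (fun k l => by simp [m', hm, mul_assoc]) c hc
    (fun v => by rw [hsum, hq]; exact h0 _)
    (fun v => by
      simp only [hsum, m', hq]
      exact h _)
    (fun i j hij => by rw [hsum]; exact hdiag i j hij)
  have htr : (∑ k, m' k k).trace = (∑ k, m k k).trace := by
    rw [hsum, mul_assoc, trace_mul_comm, mul_assoc, hU, mul_one]
  rw [htr] at key
  simpa only [m', frobenius_norm_unitary_conj hU] using key

/-! ### Separability witnesses and their norm -/

/-- Hermitian matrices that are nonnegative on the separable cone. -/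
structure IsSeparabilityWitness {d n : ℕ} (W : QuditMatrix d n) : Prop where
  isHermitian : W.IsHermitian
  nonneg : ∀ A : Fin n → Matrix (Fin d) (Fin d) ℂ, (∀ k, (A k).PosSemidef) →
    0 ≤ (W * tensorMatrix A).trace.re

/-- The block of `W` with respect to the splitting off of the first subsystem. -/
def firstBlock {d n : ℕ} (W : QuditMatrix d (n + 1)) (k l : QuditIndex d n) :
    Matrix (Fin d) (Fin d) ℂ :=
  Matrix.of fun i j => W (Fin.cons i k) (Fin.cons j l)

open Matrix in
/-- The compression of `W` to the vector `v` on the first subsystem. -/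
def firstCompression {d n : ℕ} (W : QuditMatrix d (n + 1)) (v : Fin d → ℂ) : QuditMatrix d n :=
  Matrix.of fun k l => star v ⬝ᵥ firstBlock W k l *ᵥ v

lemma sum_quditIndex_succ {M : Type*} [AddCommMonoid M] {d n : ℕ} (f : QuditIndex d (n + 1) → M) :
    ∑ i, f i = ∑ k : QuditIndex d n, ∑ i : Fin d, f (Fin.cons i k) := by
  rw [Finset.sum_comm, ← Fintype.sum_prod_type']
  exact (Fintype.sum_equiv (Fin.consEquiv fun _ => Fin d) _ _ fun _ => rfl).symm

lemma tensorMatrix_cons {d n : ℕ} (B : Matrix (Fin d) (Fin d) ℂ)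
    (A : Fin n → Matrix (Fin d) (Fin d) ℂ) (i j : Fin d) (k l : QuditIndex d n) :
    tensorMatrix (Fin.cons B A : Fin (n + 1) → Matrix (Fin d) (Fin d) ℂ)
      (Fin.cons i k) (Fin.cons j l) = B i j * tensorMatrix A k l := by
  simp [tensorMatrix, Fin.prod_univ_succ]

lemma tensorMatrix_one {d n : ℕ} :
    tensorMatrix (fun _ : Fin n => (1 : Matrix (Fin d) (Fin d) ℂ)) = 1 := by
  ext i j
  by_cases h : i = j
  · subst h
    simp [tensorMatrix]
  · obtain ⟨k, hk⟩ := Function.ne_iff.1 h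
    simp only [tensorMatrix, Matrix.of_apply, Matrix.one_apply_ne h]
    exact Finset.prod_eq_zero (Finset.mem_univ k) (Matrix.one_apply_ne hk)

open Matrix in
lemma trace_firstCompression_mul_tensorMatrix {d n : ℕ} (W : QuditMatrix d (n + 1)) (v : Fin d → ℂ)
    (A : Fin n → Matrix (Fin d) (Fin d) ℂ) :
    (firstCompression W v * tensorMatrix A).trace =
      (W * tensorMatrix (Fin.cons (vecMulVec v (star v)) A :
        Fin (n + 1) → Matrix (Fin d) (Fin d) ℂ)).trace := by
  simp only [Matrix.trace, diag_apply, mul_apply, sum_quditIndex_succ, tensorMatrix_cons]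
  refine Finset.sum_congr rfl fun k _ => ?_
  rw [Finset.sum_comm]
  refine Finset.sum_congr rfl fun l _ => ?_
  simp only [firstCompression, firstBlock, of_apply, dotProduct, mulVec, vecMulVec_apply,
    Finset.sum_mul, Finset.mul_sum, Pi.star_apply]
  exact Finset.sum_congr rfl fun _ _ => Finset.sum_congr rfl fun _ _ => by ring

open Matrix in
lemma firstBlock_conjTranspose {d n : ℕ} {W : QuditMatrix d (n + 1)} (hW : W.IsHermitian)
    (k l : QuditIndex d n) : (firstBlock W k l)ᴴ = firstBlock W l k := by
  ext i j
  exact hW.apply _ _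

lemma trace_firstCompression {d n : ℕ} (W : QuditMatrix d (n + 1)) (v : Fin d → ℂ) :
    (firstCompression W v).trace =
      dotProduct (star v) (Matrix.mulVec (∑ k, firstBlock W k k) v) := by
  rw [Matrix.sum_mulVec, dotProduct_sum]
  rfl

lemma trace_sum_firstBlock {d n : ℕ} (W : QuditMatrix d (n + 1)) :
    (∑ k, firstBlock W k k).trace = W.trace := by
  rw [Matrix.trace_sum]
  exact (sum_quditIndex_succ fun i => W i i).symm

lemma frobenius_norm_sq_eq_sum_firstBlock {d n : ℕ} (W : QuditMatrix d (n + 1)) :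
    ‖W‖ ^ 2 = ∑ k, ∑ l, ‖firstBlock W k l‖ ^ 2 := by
  simp only [frobenius_norm_sq_eq_sum, sum_quditIndex_succ]
  refine Finset.sum_congr rfl fun k _ => ?_
  rw [Finset.sum_comm]
  rfl

namespace IsSeparabilityWitness

open Matrix in
lemma firstCompression {d n : ℕ} {W : QuditMatrix d (n + 1)} (hW : IsSeparabilityWitness W)
    (v : Fin d → ℂ) : IsSeparabilityWitness (firstCompression W v) where
  isHermitian := by
    ext k l
    have h := firstBlock_conjTranspose hW.isHermitian l k
    simp only [conjTranspose_apply, _root_.firstCompression, of_apply]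
    rw [← h, star_dotProduct, star_mulVec, dotProduct_mulVec]
    simp
  nonneg A hA := by
    rw [trace_firstCompression_mul_tensorMatrix]
    exact hW.nonneg _ fun k => by
      refine Fin.cases ?_ (fun k => ?_) k
      · simpa using posSemidef_vecMulVec_self_star v
      · simpa using hA k

lemma trace_nonneg {d n : ℕ} {W : QuditMatrix d n} (hW : IsSeparabilityWitness W) :
    0 ≤ W.trace.re := by
  simpa [tensorMatrix_one] using hW.nonneg (fun _ => 1) fun _ => Matrix.PosSemidef.one

lemma norm_sq_le_succ {d n : ℕ} (hd : 1 ≤ d) {c : ℝ} (hc : 2 ≤ c * (d : ℝ) ^ n)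
    (h : ∀ W : QuditMatrix d n, IsSeparabilityWitness W → ‖W‖ ^ 2 ≤ c * W.trace.re ^ 2)
    {W : QuditMatrix d (n + 1)} (hW : IsSeparabilityWitness W) :
    ‖W‖ ^ 2 ≤ (2 * (c - 1 / (d : ℝ) ^ n) * (1 - 1 / d) + c / d) * W.trace.re ^ 2 := by
  have : Nonempty (Fin d) := ⟨⟨0, hd⟩⟩
  have key := sum_norm_sq_le_of_compression (firstBlock W)
    (firstBlock_conjTranspose hW.isHermitian) c (by simpa using hc)
    (fun v => by
      rw [← trace_firstCompression]
      exact (hW.firstCompression v).trace_nonneg)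
    (fun v => by
      rw [← trace_firstCompression]
      have := h _ (hW.firstCompression v)
      rwa [frobenius_norm_sq_eq_sum] at this)
  rw [frobenius_norm_sq_eq_sum_firstBlock, ← trace_sum_firstBlock]
  simpa using key

open Matrix in
lemma norm_sq_le_of_bipartite {d : ℕ} {W : QuditMatrix d 2} (hW : IsSeparabilityWitness W) :
    ‖W‖ ^ 2 ≤ W.trace.re ^ 2 := by
  rw [frobenius_norm_sq_eq_sum_firstBlock, ← trace_sum_firstBlock]
  refine sum_norm_sq_le_trace_sq_of_blockPositive (firstBlock W)
    (firstBlock_conjTranspose hW.isHermitian) fun v x => ?_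
  -- The compression is a witness on one subsystem, tested here on the rank-one matrix of x.
  have h := (hW.firstCompression v).nonneg
    (fun _ => vecMulVec (fun i => x fun _ => i) (star fun i => x fun _ => i))
    fun _ => posSemidef_vecMulVec_self_star _
  refine h.trans_eq (congrArg Complex.re ?_)
  simp only [Matrix.trace, diag_apply, mul_apply]
  refine Finset.sum_congr rfl fun k _ => Finset.sum_congr rfl fun l _ => ?_
  have hx : ∀ k : QuditIndex d 1, (fun _ => k 0) = k := fun k => by
    ext i
    rw [Subsingleton.elim i 0]
  simp only [tensorMatrix, of_apply, Fin.prod_univ_one, vecMulVec_apply, Pi.star_apply, hx]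
  rw [mul_comm, mul_comm (x l)]
  rfl

lemma norm_sq_le_of_subsingleton {n : ℕ} {W : QuditMatrix 1 n} (hW : IsSeparabilityWitness W) :
    ‖W‖ ^ 2 ≤ W.trace.re ^ 2 := by
  have him : (W (fun _ => 0) fun _ => 0).im = 0 := by
    have := congrArg Complex.im (hW.isHermitian.apply (fun _ => 0) fun _ => 0)
    simp at this
    linarith
  rw [frobenius_norm_sq_eq_sum]
  simp only [Fintype.sum_unique, Matrix.trace, Matrix.diag_apply]
  change ‖W (fun _ => 0) fun _ => 0‖ ^ 2 ≤ (W (fun _ => 0) fun _ => 0).re ^ 2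
  rw [← Complex.normSq_eq_norm_sq, Complex.normSq_apply, him]
  simp [sq]

lemma norm_sq_le {d : ℕ} (hd : 1 ≤ d) (n : ℕ) {W : QuditMatrix d (n + 2)}
    (hW : IsSeparabilityWitness W) :
    ‖W‖ ^ 2 ≤ (((2 * (d : ℝ) - 1) ^ n * ((d : ℝ) ^ 2 - 1) + 1) / (d : ℝ) ^ (n + 2)) *
      W.trace.re ^ 2 := by
  -- For d = 1 the constant c satisfies c dⁿ = 1, below the 2 required by the induction step.
  rcases hd.eq_or_lt with rfl | hd
  · simpa using hW.norm_sq_le_of_subsingleton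
  have hd2 : (2 : ℝ) ≤ d := by exact_mod_cast hd
  have hd0 : (d : ℝ) ≠ 0 := by positivity
  induction n with
  | zero =>
    refine hW.norm_sq_le_of_bipartite.trans_eq ?_
    field_simp
    ring
  | succ n ih =>
    refine (hW.norm_sq_le_succ hd.le ?_ fun W hW => ih hW).trans_eq ?_
    · rw [div_mul_cancel₀ _ (by positivity)]
      have h1 : (1 : ℝ) ≤ (2 * (d : ℝ) - 1) ^ n := one_le_pow₀ (by linarith)
      have h2 : (1 : ℝ) ≤ (d : ℝ) ^ 2 - 1 := by nlinarith
      linarith [one_le_mul_of_one_le_of_one_le h1 h2]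
    · congr 1
      field_simp
      ring

end IsSeparabilityWitness

/-! ### Duality between separable matrices and witnesses -/

/-- In a finite-dimensional space the convex hull of a compact set is compact. -/
lemma IsCompact.convexHull_of_finiteDimensional {E : Type*} [AddCommGroup E] [Module ℝ E]
    [TopologicalSpace E] [ContinuousAdd E] [ContinuousSMul ℝ E] [FiniteDimensional ℝ E]
    {s : Set E} (hs : IsCompact s) : IsCompact (convexHull ℝ s) := by
  -- By Carathéodory, combinations of at most dim E + 1 points suffice, so the hull is a finite
  -- union of continuous images of compact sets.
  have heq : convexHull ℝ s = ⋃ m ∈ Finset.range (Module.finrank ℝ E + 2),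
      (fun p : (Fin m → ℝ) × (Fin m → E) => ∑ i, p.1 i • p.2 i) ''
        (stdSimplex ℝ (Fin m) ×ˢ Set.univ.pi fun _ => s) := by
    apply Set.Subset.antisymm
    · intro x hx
      obtain ⟨ι, _, z, w, hz, hind, hw, hw1, rfl⟩ := eq_pos_convex_span_of_mem_convexHull hx
      let e := Fintype.equivFin ι
      have hcard : Fintype.card ι ≤ Module.finrank ℝ E + 1 :=
        hind.card_le_finrank_succ.trans (Nat.succ_le_succ (Submodule.finrank_le _))
      refine Set.mem_biUnion (x := Fintype.card ι) (by simp; omega) ?_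
      refine ⟨(w ∘ e.symm, z ∘ e.symm), ⟨⟨fun i => (hw _).le, ?_⟩, fun i _ => hz ⟨_, rfl⟩⟩, ?_⟩
      · rw [← hw1]
        exact e.symm.sum_comp w
      · exact e.symm.sum_comp fun i => w i • z i
    · intro x hx
      simp only [Set.mem_iUnion] at hx
      obtain ⟨m, -, ⟨w, z⟩, ⟨hw, hz⟩, rfl⟩ := hx
      exact (convex_convexHull ℝ s).sum_mem (fun i _ => hw.1 i) hw.2
        fun i _ => subset_convexHull ℝ s (hz i trivial)
  rw [heq]
  refine (Finset.range _).isCompact_biUnion fun m _ => ?_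
  refine IsCompact.image ((isCompact_stdSimplex ℝ _).prod (isCompact_univ_pi fun _ => hs)) ?_
  fun_prop

lemma Matrix.isCompact_setOf_posSemidef_trace_eq_one {ι : Type*} [Fintype ι] :
    IsCompact {A : Matrix ι ι ℂ | A.PosSemidef ∧ A.trace = 1} := by
  classical
  refine Metric.isCompact_of_isClosed_isBounded ?_ ?_
  · have : {A : Matrix ι ι ℂ | A.PosSemidef ∧ A.trace = 1} =
        {A | A.conjTranspose = A} ∩ (⋂ x : ι → ℂ, {A | 0 ≤ dotProduct (star x) (A.mulVec x)}) ∩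
          {A | A.trace = 1} := by
      ext A
      simp [Matrix.posSemidef_iff_dotProduct_mulVec, Matrix.IsHermitian]
    rw [this]
    refine ((isClosed_eq (by fun_prop) (by fun_prop)).inter (isClosed_iInter fun x => ?_)).inter
      (isClosed_eq (by fun_prop) (by fun_prop))
    exact isClosed_le (by fun_prop) (by fun_prop)
  · refine (Metric.isBounded_iff_subset_closedBall 0).2 ⟨1, fun A hA => ?_⟩
    have h : ‖A‖ ^ 2 ≤ 1 := by
      calc ‖A‖ ^ 2 = ∑ i, ∑ j, ‖A i j‖ ^ 2 := frobenius_norm_sq_eq_sum A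
        _ ≤ ∑ i, ∑ j, (A i i).re * (A j j).re :=
          Finset.sum_le_sum fun i _ => Finset.sum_le_sum fun j _ => hA.1.norm_sq_apply_le i j
        _ = A.trace.re ^ 2 := by
          rw [sq, Matrix.trace, Complex.re_sum, Finset.sum_mul_sum]
          rfl
        _ = 1 := by simp [hA.2]
    rw [mem_closedBall_zero_iff]
    exact (sq_le_one_iff₀ (norm_nonneg _)).1 h

lemma continuous_tensorMatrix {d n : ℕ} :
    Continuous (tensorMatrix : (Fin n → Matrix (Fin d) (Fin d) ℂ) → QuditMatrix d n) := by
  refine continuous_matrix fun i j => ?_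
  simp only [tensorMatrix, Matrix.of_apply]
  fun_prop

lemma trace_tensorMatrix {d n : ℕ} (A : Fin n → Matrix (Fin d) (Fin d) ℂ) :
    (tensorMatrix A).trace = ∏ k, (A k).trace := by
  simp only [Matrix.trace, Matrix.diag_apply, tensorMatrix, Matrix.of_apply]
  exact (Fintype.prod_sum fun k i => A k i i).symm

lemma tensorMatrix_smul {d n : ℕ} (t : Fin n → ℝ) (A : Fin n → Matrix (Fin d) (Fin d) ℂ) :
    tensorMatrix (fun k => t k • A k) = (∏ k, t k) • tensorMatrix A := by
  ext i j
  simp [tensorMatrix, Finset.prod_mul_distrib]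

lemma tensorMatrix_conjTranspose {d n : ℕ} (A : Fin n → Matrix (Fin d) (Fin d) ℂ) :
    (tensorMatrix A).conjTranspose = tensorMatrix fun k => (A k).conjTranspose := by
  ext i j
  simp [tensorMatrix]

/-- Products of density matrices. -/
def productStates (d n : ℕ) : Set (QuditMatrix d n) :=
  tensorMatrix '' Set.univ.pi fun _ => {A : Matrix (Fin d) (Fin d) ℂ | A.PosSemidef ∧ A.trace = 1}

lemma isCompact_productStates (d n : ℕ) : IsCompact (productStates d n) :=
  (isCompact_univ_pi fun _ => Matrix.isCompact_setOf_posSemidef_trace_eq_one).image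
    continuous_tensorMatrix

lemma Matrix.PosSemidef.ofReal_re_trace {ι : Type*} [Fintype ι] {A : Matrix ι ι ℂ}
    (hA : A.PosSemidef) : (A.trace.re : ℂ) = A.trace :=
  Complex.ext rfl (by simpa using (Complex.le_def.1 hA.trace_nonneg).2)

/-- A positive semidefinite factor of trace zero is zero; otherwise every factor can be divided by
its trace. -/
lemma exists_smul_productState {d n : ℕ} (A : Fin n → Matrix (Fin d) (Fin d) ℂ)
    (hA : ∀ k, (A k).PosSemidef) :
    tensorMatrix A = 0 ∨ ∃ t : ℝ, 0 ≤ t ∧ ∃ X ∈ productStates d n, tensorMatrix A = t • X := by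
  by_cases h : ∃ k, (A k).trace = 0
  · obtain ⟨k, hk⟩ := h
    left
    ext i j
    simp only [tensorMatrix, Matrix.of_apply]
    refine Finset.prod_eq_zero (Finset.mem_univ k) ?_
    rw [(hA k).trace_eq_zero_iff.1 hk]
    rfl
  · push Not at h
    right
    have h0 : ∀ k, 0 ≤ (A k).trace.re := fun k => (Complex.le_def.1 (hA k).trace_nonneg).1
    have hne : ∀ k, (A k).trace.re ≠ 0 := fun k hk => h k (by
      rw [← (hA k).ofReal_re_trace, hk, Complex.ofReal_zero])
    refine ⟨∏ k, (A k).trace.re, Finset.prod_nonneg fun k _ => h0 k,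
      tensorMatrix fun k => (A k).trace.re⁻¹ • A k, ⟨_, fun k _ => ⟨?_, ?_⟩, rfl⟩, ?_⟩
    · exact (hA k).smul (inv_nonneg.2 (h0 k))
    · rw [Matrix.trace_smul]
      nth_rw 2 [← (hA k).ofReal_re_trace]
      rw [Complex.real_smul, Complex.ofReal_inv,
        inv_mul_cancel₀ (Complex.ofReal_ne_zero.2 (hne k))]
    · rw [← tensorMatrix_smul]
      congr 1
      ext1 k
      rw [smul_smul, mul_inv_cancel₀ (hne k), one_smul]

lemma exists_trace_mul_eq {ι : Type*} [Fintype ι] [DecidableEq ι] (f : Matrix ι ι ℂ →ₗ[ℂ] ℂ) :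
    ∃ F : Matrix ι ι ℂ, ∀ X, f X = (F * X).trace := by
  refine ⟨Matrix.of fun i j => f (Matrix.single j i 1), fun X => ?_⟩
  conv_lhs => rw [Matrix.matrix_eq_sum_single X]
  simp only [map_sum, Matrix.trace, Matrix.diag_apply, Matrix.mul_apply, Matrix.of_apply]
  rw [Finset.sum_comm]
  refine Finset.sum_congr rfl fun i _ => Finset.sum_congr rfl fun j _ => ?_
  have : Matrix.single j i (X j i) = X j i • Matrix.single j i (1 : ℂ) := by simp
  rw [this, map_smul, smul_eq_mul, mul_comm]

open Matrix in
/-- A matrix has the same pairing with Hermitian matrices as its Hermitian part. -/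
lemma Matrix.re_trace_hermitianPart_mul {ι : Type*} [Fintype ι] (F X : Matrix ι ι ℂ)
    (hX : X.IsHermitian) : (((2⁻¹ : ℝ) • (F + Fᴴ)) * X).trace.re = (F * X).trace.re := by
  have h : (Fᴴ * X).trace.re = (F * X).trace.re := by
    have : (Fᴴ * X).trace = star (F * X).trace := by
      rw [← trace_conjTranspose, conjTranspose_mul, hX.eq, trace_mul_comm]
    rw [this]
    simp
  rw [smul_mul, add_mul, trace_smul, trace_add, Complex.smul_re, Complex.add_re, h]
  simp
  ring

open Matrix in
/-- A positive semidefinite matrix on which every separability witness is nonnegative is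
separable. -/
lemma isFullySeparable_of_forall_witness {d n : ℕ} {ρ : QuditMatrix d n} (hρ : ρ.PosSemidef)
    (h : ∀ W : QuditMatrix d n, IsSeparabilityWitness W → 0 ≤ (W * ρ).trace.re) :
    IsFullySeparable ρ := by
  set t := ρ.trace.re with ht
  have ht0 : 0 ≤ t := (Complex.le_def.1 hρ.trace_nonneg).1
  rcases ht0.eq_or_lt with h0 | htpos
  · have : ρ = 0 := hρ.trace_eq_zero_iff.1 (by rw [← hρ.ofReal_re_trace, ← ht, ← h0]; simp)
    rw [this]
    exact zero_mem (separableCone d n)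
  have hsub : convexHull ℝ (productStates d n) ⊆ separableCone d n := by
    refine convexHull_min ?_ (separableCone d n).convex
    rintro _ ⟨A, hA, rfl⟩
    exact Submodule.subset_span ⟨A, fun k => (hA k trivial).1, rfl⟩
  by_cases hmem : t⁻¹ • ρ ∈ convexHull ℝ (productStates d n)
  · have h1 := (separableCone d n).smul_mem ht0 (hsub hmem)
    rwa [smul_smul, mul_inv_cancel₀ htpos.ne', one_smul] at h1
  exfalso
  have hcomp := (isCompact_productStates d n).convexHull_of_finiteDimensional
  have : LocallyConvexSpace ℝ (QuditMatrix d n) :=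
    inferInstanceAs (LocallyConvexSpace ℝ (QuditIndex d n → QuditIndex d n → ℂ))
  obtain ⟨f, u, hfu, huf⟩ := RCLike.geometric_hahn_banach_closed_point (𝕜 := ℂ)
    (convex_convexHull ℝ (productStates d n)) hcomp.isClosed hmem
  obtain ⟨F, hF⟩ := exists_trace_mul_eq (f : QuditMatrix d n →ₗ[ℂ] ℂ)
  replace hF : ∀ X, f X = (F * X).trace := hF
  -- Product states have trace one, so the affine condition Re f < u on them becomes positivity of
  -- the linear pairing with V. Only Hermitian matrices are paired, so the Hermitian part of V
  -- serves as witness.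
  set V : QuditMatrix d n := (u : ℂ) • 1 - F with hV
  have hVX : ∀ X, (V * X).trace.re = u * X.trace.re - (f X).re := by
    intro X
    rw [hF, hV, sub_mul, smul_mul, one_mul, trace_sub, trace_smul]
    simp
  have hwit : IsSeparabilityWitness ((2⁻¹ : ℝ) • (V + Vᴴ)) := by
    refine ⟨?_, fun A hA => ?_⟩
    · rw [IsHermitian, conjTranspose_smul, conjTranspose_add, conjTranspose_conjTranspose,
        add_comm]
      simp
    · rw [re_trace_hermitianPart_mul _ _ (by
        rw [IsHermitian, tensorMatrix_conjTranspose]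
        exact congrArg _ (funext fun k => (hA k).1))]
      rcases exists_smul_productState A hA with h0 | ⟨s, hs, X, hX, hAX⟩
      · simp [h0]
      · rw [hAX, Matrix.mul_smul, trace_smul, Complex.smul_re, smul_eq_mul]
        refine mul_nonneg hs ?_
        have h1 := hfu X (subset_convexHull ℝ _ hX)
        obtain ⟨B, hB, rfl⟩ := hX
        have h2 : (tensorMatrix B).trace = 1 := by
          rw [trace_tensorMatrix]
          exact Finset.prod_eq_one fun k _ => (hB k trivial).2
        rw [hVX, h2]
        simp at h1 ⊢
        linarith
  have h1 := h _ hwit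
  rw [re_trace_hermitianPart_mul _ _ hρ.1, hVX, ← ht] at h1
  have h2 : (f (t⁻¹ • ρ)).re = t⁻¹ * (f ρ).re := by
    have : f (t⁻¹ • ρ) = ((t⁻¹ : ℝ) : ℂ) • f ρ := by
      rw [← map_smul]
      congr 1
    rw [this]
    simp
  have h3 : u < t⁻¹ * (f ρ).re := h2 ▸ huf
  rw [inv_mul_eq_div, lt_div_iff₀ htpos] at h3
  linarith

/-! ### The separable ball and the recursion of the radii -/

lemma sepRadius_sq_add_two {d : ℕ} (hd : 1 ≤ d) (k : ℕ) :
    sepRadius d (k + 2) ^ 2 =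
      (d : ℝ) ^ (k + 2) / ((2 * (d : ℝ) - 1) ^ k * ((d : ℝ) ^ 2 - 1) + 1) := by
  have hd1 : (1 : ℝ) ≤ d := by exact_mod_cast hd
  have h1 : (0 : ℝ) ≤ (2 * (d : ℝ) - 1) ^ k := pow_nonneg (by linarith) k
  have h2 : (0 : ℝ) ≤ (d : ℝ) ^ 2 - 1 := by nlinarith
  have he : (((k + 2 : ℕ) : ℤ) - 2) = (k : ℤ) := by push_cast; ring
  rw [sepRadius, he, zpow_natCast, Real.sq_sqrt (by positivity)]

open Matrix in
lemma Matrix.abs_re_trace_mul_le {ι : Type*} [Fintype ι] (A B : Matrix ι ι ℂ) :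
    |(A * B).trace.re| ≤ ‖A‖ * ‖B‖ := by
  refine (Complex.abs_re_le_norm _).trans ?_
  have h1 : ‖(A * B).trace‖ ≤ ∑ p : ι × ι, ‖A p.1 p.2‖ * ‖B p.2 p.1‖ := by
    rw [Fintype.sum_prod_type]
    refine (norm_sum_le _ _).trans (Finset.sum_le_sum fun i _ => ?_)
    rw [diag_apply, mul_apply]
    refine (norm_sum_le _ _).trans_eq ?_
    simp
  refine h1.trans (abs_le_of_sq_le_sq ?_ (by positivity) |> (le_abs_self _).trans)
  rw [mul_pow, frobenius_norm_sq_eq_sum, frobenius_norm_sq_eq_sum,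
    Finset.sum_comm (f := fun i j => ‖B i j‖ ^ 2), ← Fintype.sum_prod_type',
    ← Fintype.sum_prod_type']
  exact Finset.sum_mul_sq_le_sq_mul_sq _ _ _

lemma isFullySeparable_of_single {d : ℕ} {ρ : QuditMatrix d 1} (hρ : ρ.PosSemidef) :
    IsFullySeparable ρ := by
  refine Submodule.subset_span ⟨fun _ => ρ.submatrix (fun i _ => i) (fun i _ => i),
    fun _ => hρ.submatrix _, ?_⟩
  have hx : ∀ k : QuditIndex d 1, (fun _ => k 0) = k := fun k => by
    ext i
    rw [Subsingleton.elim i 0]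
  ext i j
  simp [tensorMatrix, hx]

/-- The ball of radius `sepRadius d n` around the identity consists of separable matrices. -/
theorem isFullySeparable_of_norm_sub_one_le {d n : ℕ} (hd : 1 ≤ d) (hn : 1 ≤ n)
    {ρ : QuditMatrix d n} (hρ : ρ.PosSemidef) (h : ‖ρ - 1‖ ≤ sepRadius d n) :
    IsFullySeparable ρ := by
  obtain _ | _ | n := n
  · omega
  -- With one subsystem, every positive semidefinite matrix is itself a generator of the cone.
  · exact isFullySeparable_of_single hρ
  refine isFullySeparable_of_forall_witness hρ fun W hW => ?_
  have hr0 : 0 ≤ sepRadius d (n + 2) := Real.sqrt_nonneg _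
  have htr := hW.trace_nonneg
  have hb : sepRadius d (n + 2) * ‖W‖ ≤ W.trace.re := by
    have hd1 : (1 : ℝ) ≤ d := by exact_mod_cast hd
    have h1 : (0 : ℝ) ≤ (2 * (d : ℝ) - 1) ^ n := pow_nonneg (by linarith) n
    have h2 : (0 : ℝ) ≤ (d : ℝ) ^ 2 - 1 := by nlinarith
    refine (sq_le_sq₀ (by positivity) htr).1 ?_
    rw [mul_pow, sepRadius_sq_add_two hd]
    refine (mul_le_mul_of_nonneg_left (hW.norm_sq_le hd) (by positivity)).trans_eq ?_
    have h3 : (2 * (d : ℝ) - 1) ^ n * ((d : ℝ) ^ 2 - 1) + 1 ≠ 0 := by positivity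
    field_simp
  have hsplit : (W * ρ).trace.re = W.trace.re + (W * (ρ - 1)).trace.re := by
    rw [mul_sub, mul_one, Matrix.trace_sub, Complex.sub_re]
    ring
  have h1 := (abs_le.1 (Matrix.abs_re_trace_mul_le W (ρ - 1))).1
  have h2 : ‖W‖ * ‖ρ - 1‖ ≤ ‖W‖ * sepRadius d (n + 2) :=
    mul_le_mul_of_nonneg_left h (norm_nonneg _)
  rw [hsplit]
  linarith

lemma sepRadius_two {d : ℕ} (hd : 1 ≤ d) : sepRadius d 2 = 1 := by
  have h := sepRadius_sq_add_two hd 0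
  have hd0 : (d : ℝ) ≠ 0 := by positivity
  have h1 : sepRadius d 2 ^ 2 = 1 := by
    rw [h]
    field_simp
    ring
  exact (pow_eq_one_iff_of_nonneg (Real.sqrt_nonneg _) two_ne_zero).1 h1

lemma sepRadius_succ {d : ℕ} (hd : 1 ≤ d) (k : ℕ) :
    sepRadius d (k + 3) = sepRadius d (k + 2) * Real.sqrt ((d : ℝ) /
      (2 * (1 - sepRadius d (k + 2) ^ 2 / (d : ℝ) ^ (k + 2)) * ((d : ℝ) - 1) + 1)) := by
  have hd1 : (1 : ℝ) ≤ d := by exact_mod_cast hd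
  have hd0 : (d : ℝ) ≠ 0 := by positivity
  have h1 : (0 : ℝ) ≤ (2 * (d : ℝ) - 1) ^ k := pow_nonneg (by linarith) k
  have h2 : (0 : ℝ) ≤ (d : ℝ) ^ 2 - 1 := by nlinarith
  have h3 : (0 : ℝ) < (2 * (d : ℝ) - 1) ^ k * ((d : ℝ) ^ 2 - 1) + 1 := by positivity
  have h4 : (0 : ℝ) < (2 * (d : ℝ) - 1) ^ (k + 1) * ((d : ℝ) ^ 2 - 1) + 1 := by
    have : (0 : ℝ) ≤ (2 * (d : ℝ) - 1) ^ (k + 1) := pow_nonneg (by linarith) _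
    positivity
  -- The denominator in the recursion is the ratio of two consecutive denominators of r_n², so the
  -- product telescopes.
  have hden : 2 * (1 - sepRadius d (k + 2) ^ 2 / (d : ℝ) ^ (k + 2)) * ((d : ℝ) - 1) + 1 =
      ((2 * (d : ℝ) - 1) ^ (k + 1) * ((d : ℝ) ^ 2 - 1) + 1) /
        ((2 * (d : ℝ) - 1) ^ k * ((d : ℝ) ^ 2 - 1) + 1) := by
    rw [sepRadius_sq_add_two hd]
    field_simp
    ring
  have hr : ∀ n, 0 ≤ sepRadius d n := fun n => Real.sqrt_nonneg _
  rw [hden]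
  refine (sq_eq_sq₀ (hr _) (mul_nonneg (hr _) (Real.sqrt_nonneg _))).1 ?_
  rw [mul_pow, Real.sq_sqrt (div_nonneg (by positivity) (div_pos h4 h3).le),
    sepRadius_sq_add_two hd (k + 1), sepRadius_sq_add_two hd k]
  field_simp
  ring

lemma eq_sepRadius_iff_recursion {d : ℕ} (hd : 1 ≤ d) (a : ℕ → ℝ) :
    (∀ n : ℕ, 2 ≤ n → a n = sepRadius d n) ↔
      (a 2 = 1 ∧ ∀ n : ℕ, 3 ≤ n → a n = a (n - 1) * Real.sqrt ((d : ℝ) /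
        (2 * (1 - a (n - 1) ^ 2 / (d : ℝ) ^ (n - 1)) * ((d : ℝ) - 1) + 1))) := by
  constructor
  · intro h
    refine ⟨(h 2 le_rfl).trans (sepRadius_two hd), fun n hn => ?_⟩
    obtain ⟨k, rfl⟩ := Nat.exists_eq_add_of_le' hn
    rw [h _ (by omega), h _ (by omega)]
    exact sepRadius_succ hd k
  · rintro ⟨h2, hrec⟩ n hn
    induction n, hn using Nat.le_induction with
    | base => exact h2.trans (sepRadius_two hd).symm
    | succ n hn ih =>
      obtain ⟨k, rfl⟩ := Nat.exists_eq_add_of_le' hn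
      rw [hrec _ (by omega), Nat.add_sub_cancel, ih]
      exact (sepRadius_succ hd k).symm

/-! ### Qubits -/

/-- For d = 2 both 2d - 1 and d² - 1 equal 3, so the two factors merge into one power of 3. -/
lemma sepRadius_qubit (n : ℕ) :
    sepRadius 2 (n + 1) = Real.sqrt ((2 : ℝ) ^ (n + 1) / ((3 : ℝ) ^ n + 1)) := by
  have he : (((n + 1 : ℕ) : ℤ) - 2) = (n : ℤ) - 1 := by push_cast; ring
  have h3 : ((2 : ℝ) * (2 : ℕ) - 1) = 3 := by norm_num
  have h4 : (((2 : ℕ) : ℝ) ^ 2 - 1) = 3 := by norm_num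
  rw [sepRadius, he, h3, h4, zpow_sub_one₀ (by norm_num), zpow_natCast,
    inv_mul_cancel_right₀ (by norm_num)]
  norm_num

/-- The exponent -γn is (1 - log₂ 3)n/2, and 2^(1 - log₂ 3) = 2/3. -/
lemma two_rpow_neg_qubitExponent_mul (n : ℕ) :
    (2 : ℝ) ^ (-(qubitExponent * (n : ℝ))) = Real.sqrt ((2 : ℝ) ^ n / (3 : ℝ) ^ n) := by
  have h : -(qubitExponent * (n : ℝ)) = ((1 - Real.logb 2 3) * n) * (1 / 2) := by
    rw [qubitExponent]
    ring
  rw [h, Real.rpow_mul (by norm_num), ← Real.sqrt_eq_rpow, Real.rpow_mul (by norm_num),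
    Real.rpow_sub (by norm_num), Real.rpow_one,
    Real.rpow_logb (by norm_num) (by norm_num) (by norm_num), Real.rpow_natCast, div_pow]

lemma sepRadius_qubit_eq_mul (n : ℕ) :
    sepRadius 2 (n + 1) = Real.sqrt ((3 : ℝ) ^ (n + 1 + 1) / ((3 : ℝ) ^ (n + 1) + 3)) *
      (2 : ℝ) ^ (-(qubitExponent * ((n + 1 : ℕ) : ℝ))) := by
  rw [sepRadius_qubit, two_rpow_neg_qubitExponent_mul, ← Real.sqrt_mul (by positivity)]
  congr 1
  have h : (3 : ℝ) ^ (n + 1) + 3 = 3 * ((3 : ℝ) ^ n + 1) := by ring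
  rw [h]
  field_simp
  ring

lemma tendsto_sqrt_three_pow_div :
    Filter.Tendsto (fun n : ℕ => Real.sqrt ((3 : ℝ) ^ (n + 1) / ((3 : ℝ) ^ n + 3)))
      Filter.atTop (nhds (Real.sqrt 3)) := by
  refine (Real.continuous_sqrt.tendsto 3).comp ?_
  have h0 : Filter.Tendsto (fun n : ℕ => ((1 / 3 : ℝ)) ^ n) Filter.atTop (nhds 0) :=
    tendsto_pow_atTop_nhds_zero_of_lt_one (by norm_num) (by norm_num)
  have h1 : Filter.Tendsto (fun n : ℕ => 3 / (1 + 3 * (1 / 3 : ℝ) ^ n)) Filter.atTop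
      (nhds (3 / (1 + 3 * 0))) :=
    tendsto_const_nhds.div (tendsto_const_nhds.add (h0.const_mul 3)) (by norm_num)
  rw [mul_zero, add_zero, div_one] at h1
  refine h1.congr fun n => ?_
  rw [one_div, inv_pow]
  field_simp
  ring

theorem mainTheorem1 :
    -- the separable ball; `‖·‖` is the Frobenius norm
    (∀ d n : ℕ, 1 ≤ d → 1 ≤ n → ∀ ρ : QuditMatrix d n, ρ.PosSemidef →
      ‖ρ - 1‖ ≤ sepRadius d n → IsFullySeparable ρ) ∧
    -- the radii are exactly the solution of the recursion
    (∀ d : ℕ, 1 ≤ d → ∀ a : ℕ → ℝ,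
      (∀ n : ℕ, 2 ≤ n → a n = sepRadius d n) ↔
        (a 2 = 1 ∧ ∀ n : ℕ, 3 ≤ n →
          a n = a (n - 1) * Real.sqrt ((d : ℝ) /
            (2 * (1 - a (n - 1) ^ 2 / (d : ℝ) ^ (n - 1)) * ((d : ℝ) - 1) + 1)))) ∧
    -- qubits
    (∀ n : ℕ, 1 ≤ n →
      sepRadius 2 n = Real.sqrt ((2 : ℝ) ^ n / ((3 : ℝ) ^ (n - 1) + 1)) ∧
      sepRadius 2 n = Real.sqrt ((3 : ℝ) ^ (n + 1) / ((3 : ℝ) ^ n + 3)) *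
        (2 : ℝ) ^ (-(qubitExponent * (n : ℝ)))) ∧
    Filter.Tendsto (fun n : ℕ => sepRadius 2 n / (2 : ℝ) ^ (-(qubitExponent * (n : ℝ))))
      Filter.atTop (nhds (Real.sqrt 3)) := by
  refine ⟨fun d n hd hn ρ hρ h => isFullySeparable_of_norm_sub_one_le hd hn hρ h,
    fun d hd a => eq_sepRadius_iff_recursion hd a, fun n hn => ?_, ?_⟩
  · obtain ⟨k, rfl⟩ := Nat.exists_eq_add_of_le' hn
    exact ⟨sepRadius_qubit k, sepRadius_qubit_eq_mul k⟩
  · refine tendsto_sqrt_three_pow_div.congr' ?_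
    filter_upwards [Filter.eventually_ge_atTop 1] with n hn
    obtain ⟨k, rfl⟩ := Nat.exists_eq_add_of_le' hn
    rw [sepRadius_qubit_eq_mul, mul_div_cancel_right₀ _ (Real.rpow_pos_of_pos two_pos _).ne']
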